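/- **Proposition 1.** Let $\gamma>0$ and $c\in(0,\infty)$, and consider a sequence of problems indexed by $k\in\mathbb N$ (the index is suppressed below) with dimension $p\to\infty$ and sample sizes $n_0,n_1\to\infty$, means $\mu_0,\mu_1\in\mathbb R^p$ and positive semidefinite covariance matrices $\Sigma_0,\Sigma_1\in\mathbb R^{p\times p}$. Assume that 1. $n_0-n_1=o(1)$ and $p/(n_0+n_1)\to c$; 2. $\|\mu_0-\mu_1\|^2=O(\sqrt p)$; 3. $\|\Sigma_i\|=O(1)$ in spectral norm, $i\in\{0,1\}$; 4. $\Sigma_0-\Sigma_1$ has $O(\sqrt p)$ eigenvalues of order $O(1)$ and the remaining ones are of order $O(1/\sqrt p)$. Let the training samples $x_{i,1},\dots,x_{i,n_i}\sim\mathcal N(\mu_i,\Sigma_i)$, $i\in\{0,1\}$, be independent, and let $z\sim\mathcal N(0,I_p)$ be independent of them. Put $$\hat\mu_i=\frac1{n_i}\sum_l x_{i,l},\qquad \hat\Sigma_i=\frac1{n_i-1}\sum_l (x_{i,l}-\hat\mu_i)(x_{i,l}-\hat\mu_i)^T,\qquad H_i=(I_p+\gamma\hat\Sigma_i)^{-1},$$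 $$B_i=\Sigma_i^{1/2}(H_1-H_0)\Sigma_i^{1/2},\qquad r_i=\Sigma_i^{1/2}\left[H_1(\mu_i-\hat\mu_1)-H_0(\mu_i-\hat\mu_0)\right].$$ For $i\in\{0,1\}$ consider, for a realization of the training samples, the condition that eventually $2\,\mathrm{tr} B_i^2+4\|r_i\|^2>0$ and $$\lim_{k\to\infty}\frac{60\,\mathrm{tr} B_i^2+240\,\mathrm{tr} B_i^2\,\|r_i\|^2+48\|r_i\|^4}{\left(2\,\mathrm{tr} B_i^2+4\|r_i\|^2\right)^2}=0.\qquad(\ast)$$ Then for each $i\in\{0,1\}$: * for almost every realization of the training samples at which $(\ast)$ holds, the conditional distribution, given the training samples, of $$\frac{z^TB_iz+2z^Tr_i-\mathrm{tr} B_i}{\sqrt{2\,\mathrm{tr} B_i^2+4\|r_i\|^2}}$$ converges weakly to $\mathcal N(0,1)$; * if $(\ast)$ holds almost surely, then this statistic also converges in distribution to $\mathcal N(0,1)$ unconditionally. -/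

import Mathlib

open MeasureTheory ProbabilityTheory Filter Topology Asymptotics
open scoped Matrix MatrixOrder

noncomputable section

/-- Training data: for each class `i ∈ {0, 1}`, a family of `n i` observations in `ℝ^p`. -/
abbrev TrainingSet (p : ℕ) (n : Fin 2 → ℕ) : Type :=
  (i : Fin 2) → Fin (n i) → EuclideanSpace ℝ (Fin p)

/-- Sample mean `(1/m) ∑ₗ xₗ`. -/
def sampleMean {p m : ℕ} (x : Fin m → EuclideanSpace ℝ (Fin p)) : EuclideanSpace ℝ (Fin p) :=
  (m : ℝ)⁻¹ • ∑ l, x l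

/-- Sample covariance matrix `(1/(m-1)) ∑ₗ (xₗ - x̄)(xₗ - x̄)ᵀ`. -/
def sampleCov {p m : ℕ} (x : Fin m → EuclideanSpace ℝ (Fin p)) : Matrix (Fin p) (Fin p) ℝ :=
  ((m : ℝ) - 1)⁻¹ •
    ∑ l, Matrix.vecMulVec (x l - sampleMean x).ofLp (x l - sampleMean x).ofLp

/-- Ridge estimator of the inverse covariance matrix, `H = (I + γ Σ̂)⁻¹`. -/
def ridgeInv {p m : ℕ} (γ : ℝ) (x : Fin m → EuclideanSpace ℝ (Fin p)) :
    Matrix (Fin p) (Fin p) ℝ :=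
  (1 + γ • sampleCov x)⁻¹

/-- `B_i = Σ_i^{1/2} (H_1 - H_0) Σ_i^{1/2}`. -/
def qdaB {p : ℕ} {n : Fin 2 → ℕ} (γ : ℝ) (S : Fin 2 → Matrix (Fin p) (Fin p) ℝ)
    (x : TrainingSet p n) (i : Fin 2) : Matrix (Fin p) (Fin p) ℝ :=
  CFC.sqrt (S i) * (ridgeInv γ (x 1) - ridgeInv γ (x 0)) * CFC.sqrt (S i)

/-- `r_i = Σ_i^{1/2} [H_1 (μ_i - μ̂_1) - H_0 (μ_i - μ̂_0)]`. -/
def qdaR {p : ℕ} {n : Fin 2 → ℕ} (γ : ℝ) (μ : Fin 2 → EuclideanSpace ℝ (Fin p))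
    (S : Fin 2 → Matrix (Fin p) (Fin p) ℝ) (x : TrainingSet p n) (i : Fin 2) :
    EuclideanSpace ℝ (Fin p) :=
  WithLp.toLp 2 (CFC.sqrt (S i) *ᵥ
    (ridgeInv γ (x 1) *ᵥ (μ i - sampleMean (x 1)).ofLp
      - ridgeInv γ (x 0) *ᵥ (μ i - sampleMean (x 0)).ofLp))

/-- `2 tr B² + 4 ‖r‖²`. -/
def quadVar {p : ℕ} (B : Matrix (Fin p) (Fin p) ℝ) (r : EuclideanSpace ℝ (Fin p)) : ℝ :=
  2 * (B ^ 2).trace + 4 * ‖r‖ ^ 2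

/-- `(60 tr B² + 240 tr B² ‖r‖² + 48 ‖r‖⁴) / (2 tr B² + 4 ‖r‖²)²`. -/
def lyapunovRatio {p : ℕ} (B : Matrix (Fin p) (Fin p) ℝ) (r : EuclideanSpace ℝ (Fin p)) : ℝ :=
  (60 * (B ^ 2).trace + 240 * (B ^ 2).trace * ‖r‖ ^ 2 + 48 * ‖r‖ ^ 4) / quadVar B r ^ 2

/-- `(zᵀ B z + 2 zᵀ r - tr B) / √(2 tr B² + 4 ‖r‖²)`. -/
def quadStat {p : ℕ} (B : Matrix (Fin p) (Fin p) ℝ) (r z : EuclideanSpace ℝ (Fin p)) : ℝ :=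
  (z.ofLp ⬝ᵥ (B *ᵥ z.ofLp) + 2 * (z.ofLp ⬝ᵥ r.ofLp) - B.trace) / √(quadVar B r)

/-- The Lyapunov-type condition along a sequence: the denominators are eventually positive (so
that the ratio is meaningful) and the ratio tends to `0`. -/
def LyapunovCond {p : ℕ → ℕ} (B : (k : ℕ) → Matrix (Fin (p k)) (Fin (p k)) ℝ)
    (r : (k : ℕ) → EuclideanSpace ℝ (Fin (p k))) : Prop :=
  (∀ᶠ k in atTop, 0 < quadVar (B k) (r k)) ∧
    Tendsto (fun k => lyapunovRatio (B k) (r k)) atTop (𝓝 0)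

/-- The symmetric matrix `A` has `O(√p)` eigenvalues (with multiplicity) of order `O(1)` and all
remaining eigenvalues are of order `O(1/√p)`, along a sequence of dimensions. -/
def FewLargeEigenvalues {p : ℕ → ℕ} {A : (k : ℕ) → Matrix (Fin (p k)) (Fin (p k)) ℝ}
    (hA : ∀ k, (A k).IsHermitian) : Prop :=
  ∃ M : ℝ, ∀ᶠ k in atTop, ∃ J : Finset (Fin (p k)),
    (J.card : ℝ) ≤ M * √(p k) ∧
    (∀ j ∈ J, |(hA k).eigenvalues j| ≤ M) ∧
    ∀ j ∉ J, |(hA k).eigenvalues j| ≤ M / √(p k)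

end

/-! Given the training samples, `B` and `r` are fixed and only the Gaussian `z` is random. In an
eigenbasis of `B` the centred form splits into independent terms `λ (x² - 1) + 2 b x`, with
variances `2 λ² + 4 b²` summing to `v = quadVar B r`. The claim is thus a Lyapunov central limit
theorem, proved with third moments and characteristic functions
(`norm_integral_cexp_sum_quadratic_sub_le`).

After division by `√v` the error is controlled by `max |λ| / √v + ‖r‖² / v`
(`norm_charFun_quadStat_sub_le`). Condition (∗) sends `‖r‖² / v` to `0` and `v` to infinity. The
eigenvalues stay bounded because `0 ≤ H ≤ 1` for both ridge inverses, whence `|λ| ≤ ‖Σ_i‖`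
(`abs_eigenvalues_qdaB_le`).

By independence the conditional law is that of the statistic with the training data frozen.
Averaging its characteristic function over the data gives the unconditional limit by dominated
convergence. -/

noncomputable section

/-! ### Moments of the standard Gaussian up to order four. -/

section GaussianMoments

/-- Differentiating `f e^{t²/2}` replaces `f` by `f' + t f`; iterating from `f = 1` yields the
derivatives of the Gaussian mgf, hence the moments. -/
lemma hasDerivAt_mul_exp_sq_half {f : ℝ → ℝ} {f' x : ℝ} (hf : HasDerivAt f f' x) :
    HasDerivAt (fun t => f t * Real.exp (t ^ 2 / 2)) ((f' + x * f x) * Real.exp (x ^ 2 / 2)) x := by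
  have h1 : HasDerivAt (fun t : ℝ => t ^ 2 / 2) x x := by
    simpa using (hasDerivAt_pow 2 x).div_const 2
  convert! hf.mul h1.exp using 1
  ring

lemma iteratedDeriv_mgf_stdGaussianReal :
    iteratedDeriv 3 (mgf id (gaussianReal 0 1)) =
        (fun t => (t ^ 3 + 3 * t) * Real.exp (t ^ 2 / 2)) ∧
      iteratedDeriv 4 (mgf id (gaussianReal 0 1)) =
        (fun t => (t ^ 4 + 6 * t ^ 2 + 3) * Real.exp (t ^ 2 / 2)) := by
  have h0 : mgf id (gaussianReal 0 1) = fun t => 1 * Real.exp (t ^ 2 / 2) := by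
    rw [mgf_id_gaussianReal]
    funext t
    simp
  have h1 : deriv (fun t : ℝ => 1 * Real.exp (t ^ 2 / 2)) =
      fun t => t * Real.exp (t ^ 2 / 2) := by
    funext t
    rw [(hasDerivAt_mul_exp_sq_half (hasDerivAt_const t (1 : ℝ))).deriv]
    ring
  have h2 : deriv (fun t : ℝ => t * Real.exp (t ^ 2 / 2)) =
      fun t => (t ^ 2 + 1) * Real.exp (t ^ 2 / 2) := by
    funext t
    rw [(hasDerivAt_mul_exp_sq_half (hasDerivAt_id' t)).deriv]
    ring
  have h3 : deriv (fun t : ℝ => (t ^ 2 + 1) * Real.exp (t ^ 2 / 2)) =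
      fun t => (t ^ 3 + 3 * t) * Real.exp (t ^ 2 / 2) := by
    funext t
    rw [(hasDerivAt_mul_exp_sq_half ((hasDerivAt_pow 2 t).add_const 1)).deriv]
    push_cast
    ring
  have h4 : deriv (fun t : ℝ => (t ^ 3 + 3 * t) * Real.exp (t ^ 2 / 2)) =
      fun t => (t ^ 4 + 6 * t ^ 2 + 3) * Real.exp (t ^ 2 / 2) := by
    funext t
    rw [(hasDerivAt_mul_exp_sq_half
      ((hasDerivAt_pow 3 t).fun_add ((hasDerivAt_id' t).const_mul 3))).deriv]
    push_cast
    ring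
  have h3' : iteratedDeriv 3 (mgf id (gaussianReal 0 1)) =
      fun t => (t ^ 3 + 3 * t) * Real.exp (t ^ 2 / 2) := by
    rw [iteratedDeriv_succ, iteratedDeriv_succ, iteratedDeriv_one, h0, h1, h2, h3]
  exact ⟨h3', by rw [iteratedDeriv_succ, h3', h4]⟩

lemma integral_pow_gaussianReal (m : ℕ) :
    ∫ x, x ^ m ∂(gaussianReal 0 1) = iteratedDeriv m (mgf id (gaussianReal 0 1)) 0 := by
  rw [iteratedDeriv_mgf_zero (by simp [integrableExpSet_id_gaussianReal])]
  simp

lemma integral_pow_three_gaussianReal : ∫ x, x ^ 3 ∂(gaussianReal 0 1) = 0 := by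
  simp [integral_pow_gaussianReal, iteratedDeriv_mgf_stdGaussianReal.1]

lemma integral_pow_four_gaussianReal : ∫ x, x ^ 4 ∂(gaussianReal 0 1) = 3 := by
  simp [integral_pow_gaussianReal, iteratedDeriv_mgf_stdGaussianReal.2]

lemma integral_sq_gaussianReal : ∫ x, x ^ 2 ∂(gaussianReal 0 1) = 1 := by
  have h := variance_fun_id_gaussianReal (μ := 0) (v := 1)
  rw [variance_eq_integral (by fun_prop)] at h
  simpa using h

lemma integrable_pow_gaussianReal (m : ℕ) :
    Integrable (fun x : ℝ => x ^ m) (gaussianReal 0 1) := by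
  have h := (memLp_id_gaussianReal (μ := 0) (v := 1) (m : NNReal)).integrable_norm_pow'
  refine (integrable_norm_iff (by fun_prop)).1 ?_
  simpa using h

lemma integrable_quartic_gaussianReal (c₀ c₁ c₂ c₃ c₄ : ℝ) :
    Integrable (fun x : ℝ => c₀ + c₁ * x ^ 1 + c₂ * x ^ 2 + c₃ * x ^ 3 + c₄ * x ^ 4)
      (gaussianReal 0 1) := by
  have hi (m : ℕ) (c : ℝ) := (integrable_pow_gaussianReal m).const_mul c
  exact ((((integrable_const c₀).add (hi 1 c₁)).add (hi 2 c₂)).add (hi 3 c₃)).add (hi 4 c₄)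

lemma integral_quartic_gaussianReal (c₀ c₁ c₂ c₃ c₄ : ℝ) :
    ∫ x, (c₀ + c₁ * x ^ 1 + c₂ * x ^ 2 + c₃ * x ^ 3 + c₄ * x ^ 4) ∂(gaussianReal 0 1) =
      c₀ + c₂ + 3 * c₄ := by
  have hi (m : ℕ) (c : ℝ) := (integrable_pow_gaussianReal m).const_mul c
  rw [integral_add
      ((((integrable_const c₀).fun_add (hi 1 c₁)).fun_add (hi 2 c₂)).fun_add (hi 3 c₃)) (hi 4 c₄),
    integral_add (((integrable_const c₀).fun_add (hi 1 c₁)).fun_add (hi 2 c₂)) (hi 3 c₃),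
    integral_add ((integrable_const c₀).fun_add (hi 1 c₁)) (hi 2 c₂),
    integral_add (integrable_const c₀) (hi 1 c₁)]
  have h1 : ∫ x : ℝ, x ^ 1 ∂(gaussianReal 0 1) = 0 := by
    simp only [pow_one, integral_id_gaussianReal]
  simp only [integral_const_mul, integral_pow_four_gaussianReal, integral_pow_three_gaussianReal,
    integral_sq_gaussianReal, h1]
  simp
  ring

end GaussianMoments

/-! ### Quantitative Lyapunov estimate for characteristic functions. -/

section CharFunEstimates

/-- Telescoping: factors are exchanged one at a time, and those left in place have norm at most `1`.
-/
lemma norm_prod_sub_prod_le {ι : Type*} (s : Finset ι) (f g : ι → ℂ)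
    (hf : ∀ i ∈ s, ‖f i‖ ≤ 1) (hg : ∀ i ∈ s, ‖g i‖ ≤ 1) :
    ‖∏ i ∈ s, f i - ∏ i ∈ s, g i‖ ≤ ∑ i ∈ s, ‖f i - g i‖ := by
  classical
  induction s using Finset.induction_on with
  | empty => simp
  | insert a s ha ih =>
    rw [Finset.prod_insert ha, Finset.prod_insert ha, Finset.sum_insert ha]
    have ih' := ih (fun i hi => hf i (Finset.mem_insert_of_mem hi))
      (fun i hi => hg i (Finset.mem_insert_of_mem hi))
    have hga := hg a (Finset.mem_insert_self a s)
    have hfs : ‖∏ i ∈ s, f i‖ ≤ 1 := by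
      rw [norm_prod]
      exact Finset.prod_le_one (fun _ _ => norm_nonneg _)
        fun i hi => hf i (Finset.mem_insert_of_mem hi)
    calc ‖f a * ∏ i ∈ s, f i - g a * ∏ i ∈ s, g i‖
        = ‖(f a - g a) * ∏ i ∈ s, f i + g a * (∏ i ∈ s, f i - ∏ i ∈ s, g i)‖ := by
          congr 1
          ring
      _ ≤ ‖f a - g a‖ * ‖∏ i ∈ s, f i‖ + ‖g a‖ * ‖∏ i ∈ s, f i - ∏ i ∈ s, g i‖ := by
          grw [norm_add_le, norm_mul, norm_mul]
      _ ≤ ‖f a - g a‖ * 1 + 1 * ∑ i ∈ s, ‖f i - g i‖ := by gcongr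
      _ = _ := by ring

lemma norm_cexp_mul_I_sub_taylor_le (x : ℝ) :
    ‖Complex.exp (x * Complex.I) - (1 + x * Complex.I - x ^ 2 / 2)‖ ≤ 4 * |x| ^ 3 := by
  -- For `|x| ≤ 1` the Taylor remainder is at most `|x|³ e`, and `e < 4`; for `|x| ≥ 1` each term is
  -- crudely bounded by a multiple of `|x|³`.
  rcases le_total |x| 1 with h | h
  · have h1 := Complex.norm_exp_sub_sum_le_norm_mul_exp (x * Complex.I) 3
    have h2 : ∑ m ∈ Finset.range 3, (x * Complex.I) ^ m / (m.factorial : ℂ) =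
        1 + x * Complex.I - x ^ 2 / 2 := by
      simp [Finset.sum_range_succ, mul_pow, Nat.factorial]
      ring
    have h3 : ‖(x : ℂ) * Complex.I‖ = |x| := by simp
    rw [h2, h3] at h1
    have h4 : Real.exp |x| ≤ 4 := by
      have := Real.exp_le_exp.2 h
      have := Real.exp_one_lt_d9
      linarith
    calc _ ≤ |x| ^ 3 * Real.exp |x| := h1
      _ ≤ |x| ^ 3 * 4 := by gcongr
      _ = _ := by ring
  · have h1 : ‖Complex.exp (x * Complex.I)‖ = 1 := Complex.norm_exp_ofReal_mul_I x
    have h2 : ‖(1 : ℂ) + x * Complex.I - x ^ 2 / 2‖ ≤ 1 + |x| + |x| ^ 2 / 2 := by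
      grw [norm_sub_le, norm_add_le]
      simp
    grw [norm_sub_le, h1, h2]
    have h3 : |x| ≤ |x| ^ 3 := le_self_pow₀ h (by norm_num)
    have h4 : |x| ^ 2 ≤ |x| ^ 3 := pow_le_pow_right₀ h (by norm_num)
    linarith

lemma abs_exp_neg_sub_one_sub_le {s : ℝ} (hs : 0 ≤ s) : |Real.exp (-s) - (1 - s)| ≤ s ^ 2 := by
  rcases le_total s 1 with h | h
  · have := Real.abs_exp_sub_one_sub_id_le (x := -s) (by rwa [abs_neg, abs_of_nonneg hs])
    rw [neg_sq] at this
    convert! this using 2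
    ring
  · have h1 : Real.exp (-s) ≤ 1 := Real.exp_le_one_iff.2 (by linarith)
    have h2 := Real.exp_pos (-s)
    rw [abs_le]
    constructor <;> nlinarith

/-- A constant bounding the third absolute moment of `a (x² - 1) + 2 b x` under `𝒩(0, 1)` in terms
of `|a|³ + |b|³`. -/
def thirdMomentConst : ℝ := ∫ x, 4 * (1 + |x| ^ 2) ^ 3 + 32 * |x| ^ 3 ∂(gaussianReal 0 1)

lemma integrable_abs_pow_gaussianReal (m : ℕ) :
    Integrable (fun x : ℝ => |x| ^ m) (gaussianReal 0 1) := by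
  simpa using (integrable_pow_gaussianReal m).abs

lemma integrable_thirdMomentConst :
    Integrable (fun x : ℝ => 4 * (1 + |x| ^ 2) ^ 3 + 32 * |x| ^ 3) (gaussianReal 0 1) := by
  have h : (fun x : ℝ => 4 * (1 + |x| ^ 2) ^ 3 + 32 * |x| ^ 3) = fun x : ℝ =>
      4 + 12 * |x| ^ 2 + 12 * |x| ^ 4 + 4 * |x| ^ 6 + 32 * |x| ^ 3 := by
    funext x
    ring
  rw [h]
  have hi := integrable_abs_pow_gaussianReal
  exact (((((integrable_const 4).add ((hi 2).const_mul 12)).add ((hi 4).const_mul 12)).add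
    ((hi 6).const_mul 4)).add ((hi 3).const_mul 32))

lemma thirdMomentConst_nonneg : 0 ≤ thirdMomentConst :=
  integral_nonneg fun x => by positivity

lemma add_pow_three_le {u v : ℝ} (hu : 0 ≤ u) (hv : 0 ≤ v) :
    (u + v) ^ 3 ≤ 4 * (u ^ 3 + v ^ 3) := by
  -- The difference of the two sides is `3 (u + v) (u - v)²`.
  nlinarith [mul_nonneg (add_nonneg hu hv) (sq_nonneg (u - v))]

lemma abs_quadratic_pow_three_le (a b x : ℝ) :
    |a * (x ^ 2 - 1) + 2 * b * x| ^ 3 ≤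
      (4 * (1 + |x| ^ 2) ^ 3 + 32 * |x| ^ 3) * (|a| ^ 3 + |b| ^ 3) := by
  have h1 : |a * (x ^ 2 - 1) + 2 * b * x| ≤ |a| * (1 + |x| ^ 2) + 2 * |b| * |x| := by
    refine (abs_add_le _ _).trans (add_le_add ?_ (by simp [abs_mul]))
    rw [abs_mul]
    gcongr
    refine (abs_sub _ _).trans ?_
    simp [add_comm]
  calc _ ≤ (|a| * (1 + |x| ^ 2) + 2 * |b| * |x|) ^ 3 := by gcongr
    _ ≤ 4 * ((|a| * (1 + |x| ^ 2)) ^ 3 + (2 * |b| * |x|) ^ 3) :=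
        add_pow_three_le (by positivity) (by positivity)
    _ = 4 * (1 + |x| ^ 2) ^ 3 * |a| ^ 3 + 32 * |x| ^ 3 * |b| ^ 3 := by ring
    _ ≤ _ := by
        have h2 : 0 ≤ 4 * (1 + |x| ^ 2) ^ 3 * |b| ^ 3 := by positivity
        have h3 : 0 ≤ 32 * |x| ^ 3 * |a| ^ 3 := by positivity
        linarith

lemma quadratic_eq_quartic (a b : ℝ) :
    (fun x : ℝ => a * (x ^ 2 - 1) + 2 * b * x) = fun x : ℝ =>
      -a + 2 * b * x ^ 1 + a * x ^ 2 + 0 * x ^ 3 + 0 * x ^ 4 := by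
  funext x
  ring

lemma quadratic_sq_eq_quartic (a b : ℝ) :
    (fun x : ℝ => (a * (x ^ 2 - 1) + 2 * b * x) ^ 2) = fun x : ℝ =>
      a ^ 2 + (-4 * a * b) * x ^ 1 + (4 * b ^ 2 - 2 * a ^ 2) * x ^ 2 + 4 * a * b * x ^ 3
        + a ^ 2 * x ^ 4 := by
  funext x
  ring

lemma integral_quadratic_gaussianReal (a b : ℝ) :
    ∫ x, (a * (x ^ 2 - 1) + 2 * b * x) ∂(gaussianReal 0 1) = 0 := by
  rw [quadratic_eq_quartic, integral_quartic_gaussianReal]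
  ring

lemma integral_quadratic_sq_gaussianReal (a b : ℝ) :
    ∫ x, (a * (x ^ 2 - 1) + 2 * b * x) ^ 2 ∂(gaussianReal 0 1) = 2 * a ^ 2 + 4 * b ^ 2 := by
  rw [quadratic_sq_eq_quartic, integral_quartic_gaussianReal]
  ring

/-- Second-order Taylor expansion under the integral: the variable has mean `0` and variance `2 a² +
4 b²`, and the remainder is a third absolute moment. -/
lemma norm_integral_cexp_quadratic_sub_le (a b t : ℝ) :
    ‖∫ x, Complex.exp ((t * (a * (x ^ 2 - 1) + 2 * b * x) : ℝ) * Complex.I) ∂(gaussianReal 0 1)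
        - ((1 - t ^ 2 * (2 * a ^ 2 + 4 * b ^ 2) / 2 : ℝ) : ℂ)‖
      ≤ 4 * |t| ^ 3 * thirdMomentConst * (|a| ^ 3 + |b| ^ 3) := by
  set Y : ℝ → ℝ := fun x => a * (x ^ 2 - 1) + 2 * b * x with hY
  have hYm : Measurable Y := by fun_prop
  have hYi : Integrable Y (gaussianReal 0 1) := by
    rw [hY, quadratic_eq_quartic]
    exact integrable_quartic_gaussianReal ..
  have hY2i : Integrable (fun x => Y x ^ 2) (gaussianReal 0 1) := by
    rw [quadratic_sq_eq_quartic]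
    exact integrable_quartic_gaussianReal ..
  have hEi : Integrable (fun x => Complex.exp ((t * Y x : ℝ) * Complex.I)) (gaussianReal 0 1) := by
    refine Integrable.of_bound (C := 1) (by fun_prop) (ae_of_all _ fun x => ?_)
    rw [Complex.norm_exp_ofReal_mul_I]
  have hTi : Integrable (fun x => (1 : ℂ) + ((t * Y x : ℝ) : ℂ) * Complex.I
      - ((t ^ 2 / 2 * Y x ^ 2 : ℝ) : ℂ)) (gaussianReal 0 1) :=
    ((integrable_const 1).add ((hYi.const_mul t).ofReal.mul_const _)).sub
      (hY2i.const_mul _).ofReal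
  have hT : ∫ x, ((1 : ℂ) + ((t * Y x : ℝ) : ℂ) * Complex.I
      - ((t ^ 2 / 2 * Y x ^ 2 : ℝ) : ℂ)) ∂(gaussianReal 0 1)
      = ((1 - t ^ 2 * (2 * a ^ 2 + 4 * b ^ 2) / 2 : ℝ) : ℂ) := by
    rw [integral_sub ((integrable_const 1).add ((hYi.const_mul t).ofReal.mul_const _))
        (hY2i.const_mul _).ofReal,
      integral_add (integrable_const 1) ((hYi.const_mul t).ofReal.mul_const _),
      integral_mul_const, integral_complex_ofReal, integral_complex_ofReal, integral_const_mul,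
      integral_const_mul, integral_quadratic_gaussianReal, integral_quadratic_sq_gaussianReal]
    simp
    ring
  rw [← hT, ← integral_sub hEi hTi]
  calc _ ≤ ∫ x, 4 * |t| ^ 3 * (|a| ^ 3 + |b| ^ 3) * (4 * (1 + |x| ^ 2) ^ 3 + 32 * |x| ^ 3)
        ∂(gaussianReal 0 1) := by
        refine norm_integral_le_of_norm_le (integrable_thirdMomentConst.const_mul _)
          (ae_of_all _ fun x => ?_)
        have h := norm_cexp_mul_I_sub_taylor_le (t * Y x)
        have h' : (1 : ℂ) + ((t * Y x : ℝ) : ℂ) * Complex.I - ((t * Y x : ℝ) : ℂ) ^ 2 / 2 =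
            (1 : ℂ) + ((t * Y x : ℝ) : ℂ) * Complex.I - ((t ^ 2 / 2 * Y x ^ 2 : ℝ) : ℂ) := by
          push_cast
          ring
        rw [h'] at h
        refine h.trans ?_
        rw [abs_mul, mul_pow]
        have := mul_le_mul_of_nonneg_left (abs_quadratic_pow_three_le a b x)
          (show 0 ≤ 4 * |t| ^ 3 by positivity)
        simp only [hY]
        linarith
    _ = _ := by
        rw [integral_const_mul, ← thirdMomentConst]
        ring

/-- Passing from `1 - s` to `e^{-s}` costs `s²`, which is quartic in `(a, b)`; the bounds `|a|, |b|
≤ 1` absorb it into the cubes. -/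
lemma norm_integral_cexp_quadratic_sub_exp_le {a b : ℝ} (ha : |a| ≤ 1) (hb : |b| ≤ 1) (t : ℝ) :
    ‖∫ x, Complex.exp ((t * (a * (x ^ 2 - 1) + 2 * b * x) : ℝ) * Complex.I) ∂(gaussianReal 0 1)
        - (Real.exp (-(t ^ 2 * (2 * a ^ 2 + 4 * b ^ 2) / 2)) : ℂ)‖
      ≤ (4 * |t| ^ 3 * thirdMomentConst + 8 * t ^ 4) * (|a| ^ 3 + |b| ^ 3) := by
  have h1 := norm_integral_cexp_quadratic_sub_le a b t
  set s := t ^ 2 * (2 * a ^ 2 + 4 * b ^ 2) / 2 with hs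
  have h2 : ‖(Real.exp (-s) : ℂ) - ((1 - s : ℝ) : ℂ)‖ ≤ s ^ 2 := by
    rw [← Complex.ofReal_sub, Complex.norm_real]
    exact abs_exp_neg_sub_one_sub_le (by positivity)
  have ha4 : a ^ 4 ≤ |a| ^ 3 := by
    rw [← Even.pow_abs (by decide : Even 4)]
    exact pow_le_pow_of_le_one (abs_nonneg a) ha (by norm_num)
  have hb4 : b ^ 4 ≤ |b| ^ 3 := by
    rw [← Even.pow_abs (by decide : Even 4)]
    exact pow_le_pow_of_le_one (abs_nonneg b) hb (by norm_num)
  have h3 : s ^ 2 ≤ 8 * t ^ 4 * (|a| ^ 3 + |b| ^ 3) := by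
    have h4 : (a ^ 2 + 2 * b ^ 2) ^ 2 ≤ 8 * (a ^ 4 + b ^ 4) := by
      nlinarith [sq_nonneg (a ^ 2 - b ^ 2), sq_nonneg (a ^ 2), sq_nonneg (b ^ 2)]
    calc s ^ 2 = t ^ 4 * (a ^ 2 + 2 * b ^ 2) ^ 2 := by rw [hs]; ring
      _ ≤ t ^ 4 * (8 * (|a| ^ 3 + |b| ^ 3)) := by
          gcongr
          linarith
      _ = _ := by ring
  refine (norm_sub_le_norm_sub_add_norm_sub _ ((1 - s : ℝ) : ℂ) _).trans ?_
  rw [norm_sub_rev ((1 - s : ℝ) : ℂ)]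
  calc _ ≤ 4 * |t| ^ 3 * thirdMomentConst * (|a| ^ 3 + |b| ^ 3)
        + 8 * t ^ 4 * (|a| ^ 3 + |b| ^ 3) := add_le_add h1 (h2.trans h3)
    _ = _ := by ring

/-- A quantitative Lyapunov bound: the characteristic function of `∑ aⱼ (xⱼ² - 1) + 2 bⱼ xⱼ`, for
independent standard Gaussian `xⱼ`, is close to that of `𝒩(0, 1)` if the total variance is `1`. -/
lemma norm_integral_cexp_sum_quadratic_sub_le {ι : Type*} [Fintype ι] (a b : ι → ℝ)
    (hab : ∑ j, (2 * a j ^ 2 + 4 * b j ^ 2) = 1) (t : ℝ) :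
    ‖∫ x : ι → ℝ, Complex.exp ((t * ∑ j, (a j * (x j ^ 2 - 1) + 2 * b j * x j) : ℝ) * Complex.I)
        ∂(Measure.pi fun _ => gaussianReal 0 1) - Complex.exp (-(t ^ 2) / 2)‖
      ≤ (4 * |t| ^ 3 * thirdMomentConst + 8 * t ^ 4) * ∑ j, (|a j| ^ 3 + |b j| ^ 3) := by
  have hle (j : ι) : 2 * a j ^ 2 + 4 * b j ^ 2 ≤ 1 := by
    rw [← hab]
    exact Finset.single_le_sum (f := fun j => 2 * a j ^ 2 + 4 * b j ^ 2)
      (fun i _ => by positivity) (Finset.mem_univ j)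
  have ha (j : ι) : |a j| ≤ 1 := by
    rw [← sq_le_one_iff_abs_le_one]
    nlinarith [hle j, sq_nonneg (a j), sq_nonneg (b j)]
  have hb (j : ι) : |b j| ≤ 1 := by
    rw [← sq_le_one_iff_abs_le_one]
    nlinarith [hle j, sq_nonneg (a j), sq_nonneg (b j)]
  have h1 : ∫ x : ι → ℝ,
      Complex.exp ((t * ∑ j, (a j * (x j ^ 2 - 1) + 2 * b j * x j) : ℝ) * Complex.I)
        ∂(Measure.pi fun _ => gaussianReal 0 1) =
      ∏ j, ∫ x, Complex.exp ((t * (a j * (x ^ 2 - 1) + 2 * b j * x) : ℝ) * Complex.I)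
        ∂(gaussianReal 0 1) := by
    rw [← integral_fintype_prod_eq_prod
      (f := fun j x => Complex.exp ((t * (a j * (x ^ 2 - 1) + 2 * b j * x) : ℝ) * Complex.I))]
    refine integral_congr_ae (ae_of_all _ fun x => ?_)
    simp only [← Complex.exp_sum, ← Finset.sum_mul, ← Complex.ofReal_sum, Finset.mul_sum]
  -- Total variance `1` lets the Gaussian factor be split over the same index set.
  have h2 : Complex.exp (-(t ^ 2) / 2) =
      ∏ j, (Real.exp (-(t ^ 2 * (2 * a j ^ 2 + 4 * b j ^ 2) / 2)) : ℂ) := by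
    rw [← Complex.ofReal_prod, ← Real.exp_sum, Finset.sum_neg_distrib, ← Finset.sum_div,
      ← Finset.mul_sum, hab]
    push_cast
    congr 1
    ring
  rw [h1, h2, Finset.mul_sum]
  refine (norm_prod_sub_prod_le _ _ _ (fun j _ => ?_) (fun j _ => ?_)).trans
    (Finset.sum_le_sum fun j _ => norm_integral_cexp_quadratic_sub_exp_le (ha j) (hb j) t)
  · refine (norm_integral_le_integral_norm _).trans ?_
    simp only [Complex.norm_exp_ofReal_mul_I]
    simp
  · rw [Complex.norm_real, Real.norm_eq_abs, Real.abs_exp, Real.exp_le_one_iff, neg_nonpos]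
    positivity

end CharFunEstimates

/-! ### Diagonalization of the quadratic form. -/

section QuadraticForm

variable {p : ℕ} {B : Matrix (Fin p) (Fin p) ℝ}

lemma trace_sq_eq_sum_eigenvalues_sq (hB : B.IsHermitian) :
    (B ^ 2).trace = ∑ j, hB.eigenvalues j ^ 2 := by
  conv_lhs => rw [hB.spectral_theorem, ← map_pow, Unitary.conjStarAlgAut_apply,
    Matrix.trace_mul_cycle, Unitary.coe_star_mul_self, one_mul, Matrix.diagonal_pow]
  simp [Matrix.trace_diagonal]

lemma dotProduct_mulVec_sum_eigenvectorBasis (hB : B.IsHermitian) (x : Fin p → ℝ) :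
    (∑ j, x j • hB.eigenvectorBasis j).ofLp ⬝ᵥ
        (B *ᵥ (∑ j, x j • hB.eigenvectorBasis j).ofLp) =
      ∑ j, hB.eigenvalues j * x j ^ 2 := by
  have h (j : Fin p) : Matrix.toEuclideanCLM (𝕜 := ℝ) B (hB.eigenvectorBasis j) =
      hB.eigenvalues j • hB.eigenvectorBasis j := by
    apply (WithLp.ofLp_injective 2)
    rw [Matrix.ofLp_toEuclideanCLM, hB.mulVec_eigenvectorBasis]
    simp
  rw [← Matrix.inner_toEuclideanCLM, map_sum]
  simp only [map_smul, h, smul_smul]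
  rw [hB.eigenvectorBasis.orthonormal.inner_sum]
  refine Finset.sum_congr rfl fun j _ => ?_
  simp
  ring

/-- Eigenbasis coordinates decouple the form, and the trace supplies the centring `-λ` of each term.
-/
lemma quadForm_sum_eigenvectorBasis (hB : B.IsHermitian) (r : EuclideanSpace ℝ (Fin p))
    (x : Fin p → ℝ) :
    (∑ j, x j • hB.eigenvectorBasis j).ofLp ⬝ᵥ
          (B *ᵥ (∑ j, x j • hB.eigenvectorBasis j).ofLp)
        + 2 * ((∑ j, x j • hB.eigenvectorBasis j).ofLp ⬝ᵥ r.ofLp) - B.trace =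
      ∑ j, (hB.eigenvalues j * (x j ^ 2 - 1) +
        2 * inner ℝ (hB.eigenvectorBasis j) r * x j) := by
  have h : (∑ j, x j • hB.eigenvectorBasis j).ofLp ⬝ᵥ r.ofLp =
      ∑ j, x j * inner ℝ (hB.eigenvectorBasis j) r := by
    rw [dotProduct_comm, ← star_trivial (∑ j, x j • hB.eigenvectorBasis j).ofLp,
      ← EuclideanSpace.inner_eq_star_dotProduct]
    simp [sum_inner, inner_smul_left]
  rw [dotProduct_mulVec_sum_eigenvectorBasis, h, hB.trace_eq_sum_eigenvalues, Finset.mul_sum,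
    ← Finset.sum_add_distrib, ← Finset.sum_sub_distrib]
  refine Finset.sum_congr rfl fun j _ => ?_
  simp
  ring

lemma quadVar_eq_sum (hB : B.IsHermitian) (r : EuclideanSpace ℝ (Fin p)) :
    quadVar B r = ∑ j, (2 * hB.eigenvalues j ^ 2 +
      4 * (inner ℝ (hB.eigenvectorBasis j) r) ^ 2) := by
  rw [quadVar, trace_sq_eq_sum_eigenvalues_sq hB, ← hB.eigenvectorBasis.sum_sq_inner_right r,
    Finset.mul_sum, Finset.mul_sum, Finset.sum_add_distrib]

lemma measurable_quadStat (B : Matrix (Fin p) (Fin p) ℝ) (r : EuclideanSpace ℝ (Fin p)) :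
    Measurable (quadStat B r) := by
  unfold quadStat
  refine Measurable.div_const (Continuous.measurable ?_) _
  fun_prop

lemma norm_charFun_quadStat_sub_le (hB : B.IsHermitian) (r : EuclideanSpace ℝ (Fin p))
    (hv : 0 < quadVar B r) {C : ℝ} (hC : ∀ j, |hB.eigenvalues j| ≤ C) (t : ℝ) :
    ‖charFun ((stdGaussian (EuclideanSpace ℝ (Fin p))).map (quadStat B r)) t
        - Complex.exp (-(t ^ 2) / 2)‖
      ≤ (4 * |t| ^ 3 * thirdMomentConst + 8 * t ^ 4) *
        (C / √(quadVar B r) + ‖r‖ ^ 2 / quadVar B r) := by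
  set v := quadVar B r with hvdef
  set a : Fin p → ℝ := fun j => hB.eigenvalues j / √v with ha
  set b : Fin p → ℝ := fun j => inner ℝ (hB.eigenvectorBasis j) r / √v with hb
  have hv' : 0 < √v := Real.sqrt_pos.2 hv
  have hsq : √v ^ 2 = v := Real.sq_sqrt hv.le
  have hab : ∑ j, (2 * a j ^ 2 + 4 * b j ^ 2) = 1 := by
    have : ∀ j, 2 * a j ^ 2 + 4 * b j ^ 2 = (2 * hB.eigenvalues j ^ 2 +
        4 * (inner ℝ (hB.eigenvectorBasis j) r) ^ 2) / v := fun j => by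
      simp only [ha, hb, div_pow, hsq]
      ring
    simp only [this]
    rw [← Finset.sum_div, ← quadVar_eq_sum hB, ← hvdef, div_self hv.ne']
  have hmap : charFun ((stdGaussian (EuclideanSpace ℝ (Fin p))).map (quadStat B r)) t =
      ∫ x : Fin p → ℝ, Complex.exp
        ((t * ∑ j, (a j * (x j ^ 2 - 1) + 2 * b j * x j) : ℝ) * Complex.I)
        ∂(Measure.pi fun _ => gaussianReal 0 1) := by
    have hm : Measurable fun x : Fin p → ℝ => ∑ j, x j • hB.eigenvectorBasis j := by fun_prop
    rw [charFun_apply_real,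
      integral_map (measurable_quadStat B r).aemeasurable (by fun_prop),
      -- Rotation invariance: coordinates in any orthonormal basis are independent standard
      -- Gaussians.
      stdGaussian_eq_map_pi_orthonormalBasis hB.eigenvectorBasis,
      integral_map hm.aemeasurable
        (Measurable.aestronglyMeasurable (by have := measurable_quadStat B r; fun_prop))]
    refine integral_congr_ae (ae_of_all _ fun x => ?_)
    simp only
    rw [quadStat, quadForm_sum_eigenvectorBasis hB, ← hvdef, Finset.sum_div,
      ← Complex.ofReal_mul]
    congr 4
    refine Finset.sum_congr rfl fun j _ => ?_
    simp only [ha, hb]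
    ring
  rw [hmap]
  refine (norm_integral_cexp_sum_quadratic_sub_le a b hab t).trans ?_
  have hK : 0 ≤ 4 * |t| ^ 3 * thirdMomentConst + 8 * t ^ 4 := by
    have := thirdMomentConst_nonneg
    positivity
  refine mul_le_mul_of_nonneg_left ?_ hK
  rw [Finset.sum_add_distrib]
  have hab' := hab
  rw [Finset.sum_add_distrib, ← Finset.mul_sum, ← Finset.mul_sum] at hab'
  have hb2 : ∑ j, b j ^ 2 = ‖r‖ ^ 2 / v := by
    rw [← hB.eigenvectorBasis.sum_sq_inner_right r, Finset.sum_div]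
    simp only [hb, div_pow, hsq]
  have ha0 : 0 ≤ ∑ j, a j ^ 2 := Finset.sum_nonneg fun j _ => sq_nonneg _
  have hb0 : 0 ≤ ∑ j, b j ^ 2 := Finset.sum_nonneg fun j _ => sq_nonneg _
  refine add_le_add ?_ ?_
  -- Here `∑ |a|³ ≤ max |a| · ∑ a²`, and `∑ a² ≤ 1` by the normalization. Dimension `0` is excluded
  -- since the total variance is `1`.
  · have haC (j : Fin p) : |a j| ≤ C / √v := by
      simp only [ha, abs_div, abs_of_pos hv']
      gcongr
      exact hC j
    rcases isEmpty_or_nonempty (Fin p) with hp | ⟨⟨j₀⟩⟩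
    · simp at hab
    have hC0 : 0 ≤ C / √v := (abs_nonneg _).trans (haC j₀)
    calc ∑ j, |a j| ^ 3 ≤ ∑ j, C / √v * a j ^ 2 := by
          refine Finset.sum_le_sum fun j _ => ?_
          rw [pow_succ', sq_abs]
          exact mul_le_mul_of_nonneg_right (haC j) (sq_nonneg _)
      _ = C / √v * ∑ j, a j ^ 2 := by rw [Finset.mul_sum]
      _ ≤ C / √v * 1 := by
          gcongr
          linarith
      _ = C / √v := mul_one _
  -- As `|b| ≤ 1`, cubes are at most squares, and Parseval sums the squares to `‖r‖² / v`.
  · rw [← hb2]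
    refine Finset.sum_le_sum fun j _ => ?_
    have hj : b j ^ 2 ≤ ∑ j, b j ^ 2 :=
      Finset.single_le_sum (f := fun j => b j ^ 2) (fun i _ => sq_nonneg _) (Finset.mem_univ j)
    have h1 : |b j| ≤ 1 := by
      rw [← sq_le_one_iff_abs_le_one]
      linarith
    rw [← sq_abs]
    exact pow_le_pow_of_le_one (abs_nonneg _) h1 (by norm_num)

end QuadraticForm

/-! ### Consequences of the Lyapunov condition. -/

section Lyapunov

variable {p : ℕ → ℕ} {B : (k : ℕ) → Matrix (Fin (p k)) (Fin (p k)) ℝ}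
  {r : (k : ℕ) → EuclideanSpace ℝ (Fin (p k))}

lemma trace_sq_nonneg {p : ℕ} {B : Matrix (Fin p) (Fin p) ℝ} (hB : B.IsHermitian) :
    0 ≤ (B ^ 2).trace := by
  rw [trace_sq_eq_sum_eigenvalues_sq hB]
  exact Finset.sum_nonneg fun j _ => sq_nonneg _

/-- The term `48 ‖r‖⁴` alone makes the ratio dominate `(‖r‖² / v)²`. -/
lemma LyapunovCond.tendsto_normSq_div (hB : ∀ k, (B k).IsHermitian) (h : LyapunovCond B r) :
    Tendsto (fun k => ‖r k‖ ^ 2 / quadVar (B k) (r k)) atTop (𝓝 0) := by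
  have h1 : Tendsto (fun k => √(lyapunovRatio (B k) (r k))) atTop (𝓝 0) := by
    simpa using h.2.sqrt
  refine squeeze_zero' ?_ ?_ h1
  · filter_upwards [h.1] with k hk using by positivity
  · filter_upwards [h.1] with k hk
    refine Real.le_sqrt_of_sq_le ?_
    have := trace_sq_nonneg (hB k)
    rw [lyapunovRatio, div_pow, ← pow_mul]
    gcongr
    have h2 : 0 ≤ 240 * ((B k) ^ 2).trace * ‖r k‖ ^ 2 := by positivity
    have h3 : 0 ≤ ‖r k‖ ^ 4 := by positivity
    norm_num
    linarith

/-- Once `‖r‖² < v / 8`, the trace carries most of the variance: `v < 4 tr B²`. The term `60 tr B²`,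
of degree two only, then makes the ratio dominate `v / v² = 1 / v`. -/
lemma LyapunovCond.tendsto_inv (hB : ∀ k, (B k).IsHermitian) (h : LyapunovCond B r) :
    Tendsto (fun k => (quadVar (B k) (r k))⁻¹) atTop (𝓝 0) := by
  have hr := h.tendsto_normSq_div hB
  refine squeeze_zero' ?_ ?_ h.2
  · filter_upwards [h.1] with k hk using by positivity
  · filter_upwards [h.1, hr.eventually_lt_const (show (0 : ℝ) < 1 / 8 by norm_num)] with k hk hk'
    have := trace_sq_nonneg (hB k)
    rw [div_lt_iff₀ hk] at hk'
    rw [lyapunovRatio, inv_eq_one_div, div_le_div_iff₀ hk (by positivity), one_mul, sq]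
    gcongr
    have h2 : 0 ≤ 240 * ((B k) ^ 2).trace * ‖r k‖ ^ 2 := by positivity
    have h3 : 0 ≤ 48 * ‖r k‖ ^ 4 := by positivity
    have h4 : quadVar (B k) (r k) = 2 * ((B k) ^ 2).trace + 4 * ‖r k‖ ^ 2 := rfl
    linarith

/-- A central limit theorem for quadratic forms `zᵀ Bₖ z + 2 zᵀ rₖ` in standard Gaussian vectors
with uniformly bounded spectra, in terms of characteristic functions. -/
theorem LyapunovCond.tendsto_charFun_quadStat (hB : ∀ k, (B k).IsHermitian) {C : ℝ}
    (hC : ∀ᶠ k in atTop, ∀ j, |(hB k).eigenvalues j| ≤ C) (h : LyapunovCond B r) (t : ℝ) :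
    Tendsto (fun k =>
        charFun ((stdGaussian (EuclideanSpace ℝ (Fin (p k)))).map (quadStat (B k) (r k))) t)
      atTop (𝓝 (Complex.exp (-(t ^ 2) / 2))) := by
  rw [tendsto_iff_norm_sub_tendsto_zero]
  have h1 : Tendsto (fun k => (4 * |t| ^ 3 * thirdMomentConst + 8 * t ^ 4) *
      (C * √(quadVar (B k) (r k))⁻¹ + ‖r k‖ ^ 2 / quadVar (B k) (r k))) atTop (𝓝 0) := by
    simpa using (((h.tendsto_inv hB).sqrt.const_mul C).add (h.tendsto_normSq_div hB)).const_mul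
      (4 * |t| ^ 3 * thirdMomentConst + 8 * t ^ 4)
  refine squeeze_zero' (.of_forall fun _ => norm_nonneg _) ?_ h1
  filter_upwards [h.1, hC] with k hk hCk
  rw [Real.sqrt_inv, ← div_eq_mul_inv]
  exact norm_charFun_quadStat_sub_le (hB k) (r k) hk hCk t

end Lyapunov

/-! ### Spectral bounds from `0 ≤ H ≤ 1`. -/

section RidgeBounds

variable {p m : ℕ}

lemma posSemidef_sampleCov (x : Fin m → EuclideanSpace ℝ (Fin p)) : (sampleCov x).PosSemidef := by
  rcases Nat.eq_zero_or_pos m with rfl | hm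
  -- With no observations the scalar is `-1`, but the sum is empty.
  · simpa [sampleCov] using Matrix.PosSemidef.zero
  · have hm' : (0 : ℝ) ≤ ((m : ℝ) - 1)⁻¹ := by
      have : (1 : ℝ) ≤ m := by exact_mod_cast hm
      exact inv_nonneg.2 (by linarith)
    refine Matrix.PosSemidef.smul (Matrix.posSemidef_sum _ fun l _ => ?_) hm'
    simpa using Matrix.posSemidef_vecMulVec_self_star (x l - sampleMean x).ofLp

lemma posDef_one_add_smul_sampleCov {γ : ℝ} (hγ : 0 < γ) (x : Fin m → EuclideanSpace ℝ (Fin p)) :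
    (1 + γ • sampleCov x).PosDef :=
  Matrix.PosDef.one.add_posSemidef ((posSemidef_sampleCov x).smul hγ.le)

lemma posDef_ridgeInv {γ : ℝ} (hγ : 0 < γ) (x : Fin m → EuclideanSpace ℝ (Fin p)) :
    (ridgeInv γ x).PosDef :=
  (posDef_one_add_smul_sampleCov hγ x).inv

lemma dotProduct_ridgeInv_mulVec_nonneg {γ : ℝ} (hγ : 0 < γ)
    (x : Fin m → EuclideanSpace ℝ (Fin p)) (w : Fin p → ℝ) : 0 ≤ w ⬝ᵥ (ridgeInv γ x *ᵥ w) := by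
  simpa using (posDef_ridgeInv hγ x).posSemidef.dotProduct_mulVec_nonneg w

/-- With `u = H w`, one has `w = u + γ Σ̂ u`, so `⟨w, u⟩ ≥ ‖u‖²`; expanding `‖w - u‖² ≥ 0` then
gives `‖w‖² ≥ 2⟨w, u⟩ - ‖u‖² ≥ ⟨w, u⟩`. -/
lemma dotProduct_ridgeInv_mulVec_le {γ : ℝ} (hγ : 0 < γ)
    (x : Fin m → EuclideanSpace ℝ (Fin p)) (w : Fin p → ℝ) :
    w ⬝ᵥ (ridgeInv γ x *ᵥ w) ≤ w ⬝ᵥ w := by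
  set u := ridgeInv γ x *ᵥ w with hu
  have hw : w = u + γ • (sampleCov x *ᵥ u) := by
    have hdet := (Matrix.isUnit_iff_isUnit_det _).1 (posDef_one_add_smul_sampleCov hγ x).isUnit
    have : (1 + γ • sampleCov x) *ᵥ u = w := by
      rw [hu, ridgeInv, Matrix.mulVec_mulVec, Matrix.mul_nonsing_inv _ hdet, Matrix.one_mulVec]
    rw [← this, Matrix.add_mulVec, Matrix.one_mulVec, Matrix.smul_mulVec]
  have h1 : 0 ≤ u ⬝ᵥ (sampleCov x *ᵥ u) := by
    simpa using (posSemidef_sampleCov x).dotProduct_mulVec_nonneg u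
  have h2 : u ⬝ᵥ u ≤ w ⬝ᵥ u := by
    rw [dotProduct_comm w u]
    conv_rhs => rw [hw]
    rw [dotProduct_add, dotProduct_smul, smul_eq_mul]
    have := mul_nonneg hγ.le h1
    linarith
  have h3 : 0 ≤ (w - u) ⬝ᵥ (w - u) := by simpa using dotProduct_star_self_nonneg (w - u)
  rw [sub_dotProduct, dotProduct_sub, dotProduct_sub, dotProduct_comm u w] at h3
  linarith

variable {n : Fin 2 → ℕ}

lemma isHermitian_cfcSqrt (A : Matrix (Fin p) (Fin p) ℝ) : (CFC.sqrt A).IsHermitian :=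
  (Matrix.nonneg_iff_posSemidef.1 (CFC.sqrt_nonneg A)).isHermitian

lemma isHermitian_qdaB {γ : ℝ} (hγ : 0 < γ) (S : Fin 2 → Matrix (Fin p) (Fin p) ℝ)
    (x : TrainingSet p n) (i : Fin 2) : (qdaB γ S x i).IsHermitian := by
  have h := Matrix.isHermitian_mul_mul_conjTranspose (CFC.sqrt (S i))
    ((posDef_ridgeInv hγ (x 1)).isHermitian.sub (posDef_ridgeInv hγ (x 0)).isHermitian)
  rwa [(isHermitian_cfcSqrt (S i)).eq] at h

/-- For `w = Σ^{1/2} v` both ridge forms lie in `[0, ‖w‖²]`, hence so does the modulus of their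
difference; moreover `‖w‖² = vᵀ Σ v`. -/
lemma abs_dotProduct_qdaB_mulVec_le {γ : ℝ} (hγ : 0 < γ) {S : Fin 2 → Matrix (Fin p) (Fin p) ℝ}
    (x : TrainingSet p n) {i : Fin 2} (hS : (S i).PosSemidef) (v : EuclideanSpace ℝ (Fin p)) :
    |v.ofLp ⬝ᵥ (qdaB γ S x i *ᵥ v.ofLp)| ≤
      ‖Matrix.toEuclideanCLM (𝕜 := ℝ) (S i)‖ * ‖v‖ ^ 2 := by
  set w := CFC.sqrt (S i) *ᵥ v.ofLp with hw
  have htr : v.ofLp ᵥ* CFC.sqrt (S i) = w := by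
    rw [hw, ← Matrix.vecMul_transpose]
    congr 1
    exact (isHermitian_cfcSqrt (S i)).eq.symm.trans (by simp)
  have h1 : v.ofLp ⬝ᵥ (qdaB γ S x i *ᵥ v.ofLp) =
      w ⬝ᵥ (ridgeInv γ (x 1) *ᵥ w) - w ⬝ᵥ (ridgeInv γ (x 0) *ᵥ w) := by
    rw [qdaB, ← Matrix.mulVec_mulVec, ← Matrix.mulVec_mulVec, Matrix.dotProduct_mulVec, htr, ← hw,
      Matrix.sub_mulVec, dotProduct_sub]
  have h2 : w ⬝ᵥ w = v.ofLp ⬝ᵥ (S i *ᵥ v.ofLp) := by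
    conv_lhs => rw [← htr]
    rw [← Matrix.dotProduct_mulVec, htr, hw, Matrix.mulVec_mulVec,
      CFC.sqrt_mul_sqrt_self _ hS.nonneg]
  have h3 : w ⬝ᵥ w ≤ ‖Matrix.toEuclideanCLM (𝕜 := ℝ) (S i)‖ * ‖v‖ ^ 2 := by
    rw [h2, ← Matrix.inner_toEuclideanCLM]
    refine (real_inner_le_norm _ _).trans ?_
    have := (Matrix.toEuclideanCLM (𝕜 := ℝ) (S i)).le_opNorm v
    calc _ ≤ ‖v‖ * (‖Matrix.toEuclideanCLM (𝕜 := ℝ) (S i)‖ * ‖v‖) := by gcongr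
      _ = _ := by ring
  have h4 := dotProduct_ridgeInv_mulVec_nonneg hγ (x 0) w
  have h5 := dotProduct_ridgeInv_mulVec_nonneg hγ (x 1) w
  have h6 := dotProduct_ridgeInv_mulVec_le hγ (x 0) w
  have h7 := dotProduct_ridgeInv_mulVec_le hγ (x 1) w
  rw [h1, abs_le]
  constructor <;> linarith

lemma abs_eigenvalues_qdaB_le {γ : ℝ} (hγ : 0 < γ) {S : Fin 2 → Matrix (Fin p) (Fin p) ℝ}
    (x : TrainingSet p n) {i : Fin 2} (hS : (S i).PosSemidef) (j : Fin p) :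
    |(isHermitian_qdaB hγ S x i).eigenvalues j| ≤ ‖Matrix.toEuclideanCLM (𝕜 := ℝ) (S i)‖ := by
  have h := abs_dotProduct_qdaB_mulVec_le hγ x hS
    ((isHermitian_qdaB hγ S x i).eigenvectorBasis j)
  rw [(isHermitian_qdaB hγ S x i).eigenvectorBasis.orthonormal.norm_eq_one] at h
  rw [(isHermitian_qdaB hγ S x i).eigenvalues_eq j]
  simpa using h

end RidgeBounds

/-! ### Joint measurability of the statistic. -/

section Continuity

variable {p m : ℕ} {n : Fin 2 → ℕ}

@[fun_prop]
lemma continuous_sampleMean :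
    Continuous (sampleMean : (Fin m → EuclideanSpace ℝ (Fin p)) → EuclideanSpace ℝ (Fin p)) := by
  unfold sampleMean
  fun_prop

@[fun_prop]
lemma continuous_sampleCov :
    Continuous (sampleCov : (Fin m → EuclideanSpace ℝ (Fin p)) → Matrix (Fin p) (Fin p) ℝ) := by
  unfold sampleCov
  have h (l : Fin m) : Continuous fun x : Fin m → EuclideanSpace ℝ (Fin p) =>
      Matrix.vecMulVec (x l - sampleMean x).ofLp (x l - sampleMean x).ofLp :=
    Continuous.matrix_vecMulVec (by fun_prop) (by fun_prop)
  exact Continuous.const_smul (continuous_finsetSum _ fun l _ => h l) ((m : ℝ) - 1)⁻¹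

lemma continuous_ridgeInv {γ : ℝ} (hγ : 0 < γ) :
    Continuous (ridgeInv γ : (Fin m → EuclideanSpace ℝ (Fin p)) → Matrix (Fin p) (Fin p) ℝ) := by
  have hA : Continuous fun x : Fin m → EuclideanSpace ℝ (Fin p) => 1 + γ • sampleCov x := by
    fun_prop
  -- Cramer's formula exhibits the inverse as a continuous function, the determinant being positive.
  have h : (ridgeInv γ : (Fin m → EuclideanSpace ℝ (Fin p)) → Matrix (Fin p) (Fin p) ℝ) =
      fun x => (1 + γ • sampleCov x).det⁻¹ • (1 + γ • sampleCov x).adjugate := by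
    funext x
    rw [ridgeInv, Matrix.inv_def, Ring.inverse_eq_inv']
  rw [h]
  exact (hA.matrix_det.inv₀ fun x => (posDef_one_add_smul_sampleCov hγ x).det_pos.ne').smul
    hA.matrix_adjugate

lemma continuous_qdaB {γ : ℝ} (hγ : 0 < γ) (S : Fin 2 → Matrix (Fin p) (Fin p) ℝ) (i : Fin 2) :
    Continuous fun x : TrainingSet p n => qdaB γ S x i := by
  have h0 := (continuous_ridgeInv (p := p) (m := n 0) hγ)
  have h1 := (continuous_ridgeInv (p := p) (m := n 1) hγ)
  unfold qdaB
  exact (continuous_const.matrix_mul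
    ((h1.comp (continuous_apply 1)).sub (h0.comp (continuous_apply 0)))).matrix_mul continuous_const

lemma continuous_qdaR {γ : ℝ} (hγ : 0 < γ) (μ : Fin 2 → EuclideanSpace ℝ (Fin p))
    (S : Fin 2 → Matrix (Fin p) (Fin p) ℝ) (i : Fin 2) :
    Continuous fun x : TrainingSet p n => qdaR γ μ S x i := by
  have h (j : Fin 2) : Continuous fun x : TrainingSet p n =>
      ridgeInv γ (x j) *ᵥ (μ i - sampleMean (x j)).ofLp :=
    ((continuous_ridgeInv (p := p) (m := n j) hγ).comp (continuous_apply j)).matrix_mulVec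
      (by fun_prop)
  unfold qdaR
  exact (PiLp.continuous_toLp 2 _).comp (continuous_const.matrix_mulVec ((h 1).sub (h 0)))

lemma measurable_quadStat_qda {γ : ℝ} (hγ : 0 < γ) (μ : Fin 2 → EuclideanSpace ℝ (Fin p))
    (S : Fin 2 → Matrix (Fin p) (Fin p) ℝ) (i : Fin 2) :
    Measurable fun q : TrainingSet p n × EuclideanSpace ℝ (Fin p) =>
      quadStat (qdaB γ S q.1 i) (qdaR γ μ S q.1 i) q.2 := by
  have hB := (continuous_qdaB (n := n) hγ S i).comp
    (continuous_fst (Y := EuclideanSpace ℝ (Fin p)))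
  have hr := (continuous_qdaR (n := n) hγ μ S i).comp
    (continuous_fst (Y := EuclideanSpace ℝ (Fin p)))
  have hz : Continuous fun q : TrainingSet p n × EuclideanSpace ℝ (Fin p) => q.2.ofLp := by
    fun_prop
  have hr' := (PiLp.continuous_ofLp 2 _).comp hr
  unfold quadStat quadVar
  -- The denominator may vanish, so only measurability of the quotient is available.
  refine Measurable.div (Continuous.measurable ?_) (Continuous.measurable ?_)
  · exact ((hz.dotProduct (hB.matrix_mulVec hz)).add
      (continuous_const.mul (hz.dotProduct hr'))).sub hB.matrix_trace
  · exact ((continuous_const.mul (hB.pow 2).matrix_trace).add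
      (continuous_const.mul (hr.norm.pow 2))).sqrt

end Continuity

/-! ### Freezing the training data. -/

section ConditionalLaw

variable {Ω α β : Type*} [MeasurableSpace Ω] [MeasurableSpace α] [MeasurableSpace β]
  {P : Measure Ω} {X : Ω → α} {Y : Ω → β} {ν : Measure β}
  [IsProbabilityMeasure ν]

/-- If `Y` has law `ν` and is independent of `X`, then the conditional law of `g (X, Y)` given
`X = x` is the law of `g (x, ·)` under `ν`. -/
lemma condDistrib_comp_prodMk_ae_eq_of_indepFun [IsProbabilityMeasure P]
    (hX : AEMeasurable X P) (hY : HasLaw Y ν P) (hXY : IndepFun X Y P) {g : α × β → ℝ} (hg : Measurable g) :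
    ∀ᵐ ω ∂P, condDistrib (fun ω => g (X ω, Y ω)) X P (X ω) = ν.map fun y => g (X ω, y) := by
  set κ : Kernel α ℝ := (Kernel.id ×ₖ Kernel.const α ν).map g with hκ
  have hκa (x : α) : κ x = ν.map fun y => g (x, y) := by
    rw [hκ, Kernel.map_apply _ hg, Kernel.prod_apply, Kernel.id_apply, Kernel.const_apply,
      Measure.dirac_prod, Measure.map_map hg (by fun_prop)]
    rfl
  have : IsMarkovKernel κ := Kernel.IsMarkovKernel.map _ hg
  have hYm := hY.aemeasurable
  have hpair : P.map (fun ω => (X ω, Y ω)) = (P.map X).prod ν := by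
    rw [(indepFun_iff_map_prod_eq_prod_map_map hX hYm).1 hXY, hY.map_eq]
  have := Measure.isProbabilityMeasure_map hX
  have h : condDistrib (fun ω => g (X ω, Y ω)) X P =ᵐ[P.map X] κ := by
    have hgm : AEMeasurable (fun ω => g (X ω, Y ω)) P := hg.comp_aemeasurable (hX.prodMk hYm)
    refine condDistrib_ae_eq_of_measure_eq_compProd X hgm ?_
    have h1 : P.map (fun ω => (X ω, g (X ω, Y ω))) =
        (P.map (fun ω => (X ω, Y ω))).map (fun q => (q.1, g q)) := by
      rw [AEMeasurable.map_map_of_aemeasurable (by fun_prop) (hX.prodMk hYm)]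
      rfl
    rw [h1, hpair]
    ext s hs
    rw [Measure.map_apply (by fun_prop) hs, Measure.prod_apply ((by fun_prop : Measurable
      fun q : α × β => (q.1, g q)) hs), Measure.compProd_apply hs]
    refine lintegral_congr fun x => ?_
    rw [hκa, Measure.map_apply (by fun_prop) (measurable_prodMk_left hs)]
    rfl
  filter_upwards [ae_of_ae_map hX h] with ω hω
  rw [hω, hκa]

/-- Fubini on the product law of `(X, Y)`; this links the unconditional law to the frozen ones. -/
lemma charFun_map_eq_integral_charFun_of_indepFun [IsProbabilityMeasure P]
    (hX : AEMeasurable X P) (hY : HasLaw Y ν P) (hXY : IndepFun X Y P) {g : α × β → ℝ} (hg : Measurable g) (t : ℝ) :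
    charFun (P.map fun ω => g (X ω, Y ω)) t =
      ∫ ω, charFun (ν.map fun y => g (X ω, y)) t ∂P := by
  have hYm := hY.aemeasurable
  have hpair : P.map (fun ω => (X ω, Y ω)) = (P.map X).prod ν := by
    rw [(indepFun_iff_map_prod_eq_prod_map_map hX hYm).1 hXY, hY.map_eq]
  have := Measure.isProbabilityMeasure_map hX
  have hm : Measurable fun q : α × β => Complex.exp (t * g q * Complex.I) := by fun_prop
  have hi : Integrable (fun q : α × β => Complex.exp (t * g q * Complex.I))
      ((P.map X).prod ν) := by
    refine Integrable.of_bound (C := 1) hm.aestronglyMeasurable (ae_of_all _ fun q => ?_)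
    rw [← Complex.ofReal_mul, Complex.norm_exp_ofReal_mul_I]
  have h1 : charFun (P.map fun ω => g (X ω, Y ω)) t =
      ∫ q, Complex.exp (t * g q * Complex.I) ∂((P.map X).prod ν) := by
    have hgm : AEMeasurable (fun ω => g (X ω, Y ω)) P := hg.comp_aemeasurable (hX.prodMk hYm)
    rw [charFun_apply_real, integral_map hgm (by fun_prop),
      ← hpair, integral_map (hX.prodMk hYm) hm.aestronglyMeasurable]
  rw [h1, integral_prod _ hi, integral_map hX hi.aestronglyMeasurable.integral_prod_right']
  refine integral_congr_ae (ae_of_all _ fun ω => ?_)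
  simp only
  rw [charFun_apply_real, integral_map (by fun_prop) (by fun_prop)]

lemma aestronglyMeasurable_charFun_map (hX : AEMeasurable X P) {g : α × β → ℝ} (hg : Measurable g)
    (t : ℝ) : AEStronglyMeasurable (fun ω => charFun (ν.map fun y => g (X ω, y)) t) P := by
  have h (x : α) : charFun (ν.map fun y => g (x, y)) t =
      ∫ y, Complex.exp (t * g (x, y) * Complex.I) ∂ν := by
    rw [charFun_apply_real, integral_map (by fun_prop) (by fun_prop)]
  simp only [h]
  have hm : StronglyMeasurable fun q : α × β => Complex.exp (t * g q * Complex.I) :=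
    (by fun_prop : Measurable _).stronglyMeasurable
  exact (hm.integral_prod_right'.measurable.comp_aemeasurable hX).aestronglyMeasurable

end ConditionalLaw

end

/-! ### Conditional and unconditional limits. -/

theorem proposition1
    -- dimensions, sample sizes, regularization parameter, class means and covariance matrices
    (p : ℕ → ℕ) (n : Fin 2 → ℕ → ℕ) (γ c : ℝ) (hγ : 0 < γ) (hc : 0 < c)
    (μ : Fin 2 → (k : ℕ) → EuclideanSpace ℝ (Fin (p k)))
    (S : Fin 2 → (k : ℕ) → Matrix (Fin (p k)) (Fin (p k)) ℝ)
    (hS : ∀ i k, (S i k).PosSemidef)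
    -- double asymptotic regime
    (hp : Tendsto p atTop atTop) (hn : ∀ i, Tendsto (n i) atTop atTop)
    (hn01 : Tendsto (fun k => (n 0 k : ℝ) - (n 1 k : ℝ)) atTop (𝓝 0))
    (hpn : Tendsto (fun k => (p k : ℝ) / ((n 0 k : ℝ) + (n 1 k : ℝ))) atTop (𝓝 c))
    -- mean scaling
    (hμ : (fun k => ‖μ 0 k - μ 1 k‖ ^ 2) =O[atTop] (fun k => √(p k)))
    -- covariance scaling, in spectral norm
    (hSbdd : ∀ i, (fun k => ‖Matrix.toEuclideanCLM (𝕜 := ℝ) (S i k)‖) =O[atTop]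
      (fun _ => (1 : ℝ)))
    (hSdiff : FewLargeEigenvalues
      (fun k => (hS 0 k).isHermitian.sub (hS 1 k).isHermitian))
    -- independent Gaussian training samples and the independent vector `z`
    {Ω : Type*} [MeasurableSpace Ω] (P : Measure Ω) [IsProbabilityMeasure P]
    (X : (k : ℕ) → Ω → TrainingSet (p k) (fun i => n i k))
    (z : (k : ℕ) → Ω → EuclideanSpace ℝ (Fin (p k)))
    (hX : ∀ k i l, HasLaw (fun ω => X k ω i l) (multivariateGaussian (μ i k) (S i k)) P)
    (hXindep : ∀ k, iIndepFun
      (fun (a : (i : Fin 2) × Fin (n i k)) ω => X k ω a.1 a.2) P)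
    (hz : ∀ k, HasLaw (z k) (stdGaussian (EuclideanSpace ℝ (Fin (p k)))) P)
    (hXz : ∀ k, IndepFun (X k) (z k) P)
    (i : Fin 2) :
    let B : (k : ℕ) → Ω → Matrix (Fin (p k)) (Fin (p k)) ℝ :=
      fun k ω => qdaB γ (fun j => S j k) (X k ω) i
    let r : (k : ℕ) → Ω → EuclideanSpace ℝ (Fin (p k)) :=
      fun k ω => qdaR γ (fun j => μ j k) (fun j => S j k) (X k ω) i
    let Z : (k : ℕ) → Ω → ℝ := fun k ω => quadStat (B k ω) (r k ω) (z k ω)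
    -- conditionally on the training samples, almost surely where the condition holds
    (∀ᵐ ω ∂P, LyapunovCond (fun k => B k ω) (fun k => r k ω) →
      Tendsto (β := ProbabilityMeasure ℝ)
        (fun k => ⟨condDistrib (Z k) (X k) P (X k ω), inferInstance⟩) atTop
        (𝓝 ⟨gaussianReal 0 1, inferInstance⟩)) ∧
    -- unconditionally, if the condition holds almost surely
    ((∀ᵐ ω ∂P, LyapunovCond (fun k => B k ω) (fun k => r k ω)) →
      TendstoInDistribution Z atTop (id : ℝ → ℝ) (fun _ => P) (gaussianReal 0 1)) := by
  intro B r Z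
  have hXm (k : ℕ) : AEMeasurable (X k) P :=
    aemeasurable_pi_lambda _ fun i => aemeasurable_pi_lambda _ fun l => (hX k i l).aemeasurable
  let g (k : ℕ) (q : TrainingSet (p k) (fun i => n i k) × EuclideanSpace ℝ (Fin (p k))) : ℝ :=
    quadStat (qdaB γ (fun j => S j k) q.1 i) (qdaR γ (fun j => μ j k) (fun j => S j k) q.1 i) q.2
  have hg (k : ℕ) : Measurable (g k) := measurable_quadStat_qda hγ (fun j => μ j k)
    (fun j => S j k) i
  obtain ⟨C, hC⟩ := (hSbdd i).bound
  -- A deterministic statement for each fixed realization; no null set is involved.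
  have hlim (ω : Ω) (hω : LyapunovCond (fun k => B k ω) (fun k => r k ω)) (t : ℝ) :
      Tendsto (fun k => charFun ((stdGaussian (EuclideanSpace ℝ (Fin (p k)))).map
        fun y => quadStat (B k ω) (r k ω) y) t) atTop (𝓝 (charFun (gaussianReal 0 1) t)) := by
    have h := hω.tendsto_charFun_quadStat (fun k => isHermitian_qdaB hγ _ (X k ω) i) (C := C)
      (by
        filter_upwards [hC] with k hk j
        refine (abs_eigenvalues_qdaB_le hγ (X k ω) (hS i k) j).trans ?_
        simpa using hk) t
    rw [charFun_gaussianReal]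
    convert! h using 2
    congr 1
    simp
    ring
  refine ⟨?_, fun hcond => ?_⟩
  · have hcd (k : ℕ) : ∀ᵐ ω ∂P, condDistrib (Z k) (X k) P (X k ω) =
        (stdGaussian (EuclideanSpace ℝ (Fin (p k)))).map
          fun y => quadStat (B k ω) (r k ω) y :=
      condDistrib_comp_prodMk_ae_eq_of_indepFun (hXm k) (hz k) (hXz k) (g := g k) (hg k)
    -- Countably many `k`, so one null set serves the whole sequence.
    filter_upwards [ae_all_iff.2 hcd] with ω hω hcond
    refine ProbabilityMeasure.tendsto_iff_tendsto_charFun.2 fun t => ?_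
    simpa only [ProbabilityMeasure.coe_mk, hω] using hlim ω hcond t
  · have hZm (k : ℕ) : AEMeasurable (Z k) P := by
      have h : AEMeasurable (fun ω => (X k ω, z k ω)) P := (hXm k).prodMk (hz k).aemeasurable
      have h' : AEMeasurable (g k ∘ fun ω => (X k ω, z k ω)) P := (hg k).comp_aemeasurable h
      exact h'
    refine ⟨hZm, by fun_prop, ProbabilityMeasure.tendsto_iff_tendsto_charFun.2 fun t => ?_⟩
    simp only [ProbabilityMeasure.coe_mk, Measure.map_id]
    have hchar (k : ℕ) : charFun (P.map (Z k)) t =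
        ∫ ω, charFun ((stdGaussian (EuclideanSpace ℝ (Fin (p k)))).map
          fun y => quadStat (B k ω) (r k ω) y) t ∂P :=
      charFun_map_eq_integral_charFun_of_indepFun (hXm k) (hz k) (hXz k) (g := g k) (hg k) t
    have hm (k : ℕ) : AEStronglyMeasurable (fun ω =>
        charFun ((stdGaussian (EuclideanSpace ℝ (Fin (p k)))).map
          fun y => quadStat (B k ω) (r k ω) y) t) P :=
      aestronglyMeasurable_charFun_map (hXm k) (g := g k) (hg k) t
    simp only [hchar]
    have hconst : charFun (gaussianReal 0 1) t = ∫ _, charFun (gaussianReal 0 1) t ∂P := by simp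
    rw [hconst]
    -- Characteristic functions of probability measures are bounded by `1`, which dominates.
    refine tendsto_integral_of_dominated_convergence (fun _ => 1)
      hm (integrable_const _)
      (fun k => ae_of_all _ fun ω => ?_) ?_
    · have := Measure.isProbabilityMeasure_map (μ := stdGaussian (EuclideanSpace ℝ (Fin (p k))))
        (measurable_quadStat (B k ω) (r k ω)).aemeasurable
      exact norm_charFun_le_one t
    · filter_upwards [hcond] with ω hω using hlim ω hω t
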